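/- For a real matrix $\Psi$ with $N$ columns and an integer $k\ge 1$ let $$\rho^-(k,\Psi)=\min\frac{\|\Psi_T h_T\|^2}{\|h_T\|^2},\qquad \rho^+(k,\Psi)=\max\frac{\|\Psi_T h_T\|^2}{\|h_T\|^2},$$ where both extrema are over all $T\subseteq\{1,\dots,N\}$ with $|T|\le k$ and all $h\in\mathbb R^N$ with $h_T\neq 0$; here $\Psi_T$ is the submatrix of the columns of $\Psi$ indexed by $T$, $h_T$ is the restriction of $h$ to $T$, and $\|\cdot\|$ is the Euclidean norm. There are absolute constants $\tau,c,C>0$ with the following property. Let $M_n,N_n,k_n$ be sequences of positive integers with $M_n\to\infty$ and $k_n\log N_n=o(M_n)$. Then there is a deterministic sequence $e_n=o(\sqrt{M_n})$ such that, for all sufficiently large $n$ and every random $M_n\times N_n$ matrix $\Phi$ whose entries are independent standard Gaussians $\mathcal N(0,1)$, writing $M=M_n$, $k=k_n$, with probability larger than $1-Ce^{-cM}$ one has $$\sqrt{\rho^+(k,\Phi)}\le\tfrac{17}{16}\sqrt{M}+e_n,\qquad \sqrt{\rho^-(k,\Phi)}\ge\tfrac{15}{16}\sqrt{M}-e_n,$$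 and, simultaneously for every submatrix $\tilde\Phi$ consisting of $\tilde M$ of the rows of $\Phi$ such that $\chi:=(M-\tilde M)/M$ satisfies $\chi(1-\log\chi)\le\tau$ (the left side being read as $0$ when $\chi=0$), $$\sqrt{\rho^+(k,\tilde\Phi)}\le\tfrac{17}{16}\sqrt{\tilde M}+e_n,\qquad \sqrt{\rho^-(k,\tilde\Phi)}\ge\tfrac{15}{16}\sqrt{\tilde M}-e_n .$$ In particular this applies to the submatrix of unsaturated rows, which may depend on $\Phi$. -/

import Mathlib

open MeasureTheory ProbabilityTheory Filter Asymptotics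

noncomputable section

/-- `Φ` is a Gaussian random matrix under `P`: its entries are independent standard normal
random variables. -/
structure IsGaussianMatrix {Ω : Type*} [MeasurableSpace Ω] (P : Measure Ω) {M N : ℕ}
    (Φ : Ω → Matrix (Fin M) (Fin N) ℝ) : Prop where
  hasLaw : ∀ i j, HasLaw (fun ω => Φ ω i j) (gaussianReal 0 1) P
  indep : iIndepFun (fun (p : Fin M × Fin N) ω => Φ ω p.1 p.2) P

/-- The submatrix `Ψ_T` of the columns of `Ψ` with index in `T`. -/
def colSub {m n : Type*} (Ψ : Matrix m n ℝ) (T : Finset n) : Matrix m T ℝ :=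
  Ψ.submatrix id Subtype.val

/-- The submatrix of the rows of `Ψ` with index in `R`. -/
def rowSub {m n : Type*} (Ψ : Matrix m n ℝ) (R : Finset m) : Matrix R n ℝ :=
  Ψ.submatrix Subtype.val id

/-- The quotients `‖Ψ_T h_T‖² / ‖h_T‖²` (Euclidean norms) over all column sets `T` with
`|T| ≤ k` and all vectors `h` whose restriction `h_T` to `T` is nonzero. -/
def restrictedQuotients {m n : Type*} [Fintype m] (k : ℕ) (Ψ : Matrix m n ℝ) : Set ℝ :=
  {r | ∃ (T : Finset n) (h : n → ℝ), T.card ≤ k ∧ T.restrict h ≠ 0 ∧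
    r = ‖WithLp.toLp 2 ((colSub Ψ T).mulVec (T.restrict h))‖ ^ 2 /
          ‖WithLp.toLp 2 (T.restrict h)‖ ^ 2}

/-- `ρ⁻(k, Ψ)`: the minimum of `‖Ψ_T h_T‖² / ‖h_T‖²` over `|T| ≤ k` and `h`. -/
def rhoMinus {m n : Type*} [Fintype m] (k : ℕ) (Ψ : Matrix m n ℝ) : ℝ :=
  sInf (restrictedQuotients k Ψ)

/-- `ρ⁺(k, Ψ)`: the maximum of `‖Ψ_T h_T‖² / ‖h_T‖²` over `|T| ≤ k` and `h`. -/
def rhoPlus {m n : Type*} [Fintype m] (k : ℕ) (Ψ : Matrix m n ℝ) : ℝ :=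
  sSup (restrictedQuotients k Ψ)

/-- The set defining `ρ⁻` and `ρ⁺` is nonempty as soon as `k ≥ 1` and there is a column. -/
theorem restrictedQuotients_nonempty {m n : Type*} [Fintype m] [Nonempty n] {k : ℕ}
    (hk : 1 ≤ k) (Ψ : Matrix m n ℝ) : (restrictedQuotients k Ψ).Nonempty := by
  obtain ⟨j⟩ := ‹Nonempty n›
  refine ⟨_, {j}, fun _ => 1, by simpa using hk, fun h => ?_, rfl⟩
  have := congrFun h ⟨j, Finset.mem_singleton_self j⟩
  simp at this

theorem restrictedQuotients_bddBelow {m n : Type*} [Fintype m] (k : ℕ)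
    (Ψ : Matrix m n ℝ) : BddBelow (restrictedQuotients k Ψ) := by
  refine ⟨0, ?_⟩
  rintro r ⟨T, h, -, -, rfl⟩
  positivity

open scoped Matrix.Norms.L2Operator in
theorem restrictedQuotients_bddAbove {m n : Type*} [Fintype m] [Fintype n] (k : ℕ)
    (Ψ : Matrix m n ℝ) : BddAbove (restrictedQuotients k Ψ) := by
  classical
  refine ⟨∑ T : Finset n, ‖colSub Ψ T‖ ^ 2, ?_⟩
  rintro r ⟨T, h, -, hne, rfl⟩
  have h1 := Matrix.l2_opNorm_mulVec (colSub Ψ T) (WithLp.toLp 2 (T.restrict h))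
  have h2 : ‖colSub Ψ T‖ ^ 2 ≤ ∑ T : Finset n, ‖colSub Ψ T‖ ^ 2 :=
    Finset.single_le_sum (f := fun T : Finset n => ‖colSub Ψ T‖ ^ 2)
      (fun _ _ => by positivity) (Finset.mem_univ T)
  refine le_trans ?_ h2
  have h3 : 0 < ‖WithLp.toLp 2 (T.restrict h)‖ := by
    rw [norm_pos_iff]
    simpa using hne
  rw [div_le_iff₀ (by positivity), ← mul_pow]
  exact pow_le_pow_left₀ (norm_nonneg _) h1 2

end

/-! The error sequence can be taken to be zero: the slack `1/16` in the constants `17/16` and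
`15/16` lets a net argument with chi-square tails replace sharp comparison inequalities for
Gaussian matrices.

Fix a column set `T` of the maximal size `min k N` (smaller sets extend by zero,
`exists_of_mem_restrictedQuotients`) and a unit vector `y` supported on it. The coordinates of
`Φ_T y` are independent standard Gaussians, so the sum of their squares over a row set `R` is
chi-square with `|R|` degrees of freedom. Chernoff's bound puts it between `9/10 * |R|` and
`11/10 * |R|` up to probability `exp (-|R| / 500)` on each side (`chiSq_upper_tail`,
`chiSq_lower_tail`).

The upper bound is needed only for all rows, since deleting rows decreases the norm. The lower
bound is needed for every `R` missing at most a proportion `1/10000` of the rows. There are at most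
`exp (11/10000 * M)` such sets (`card_large_finsets_le`), which is beaten by the tail bound; this is
why `τ = 1/10000` works, as `χ ≤ χ * (1 - log χ)` for `0 ≤ χ ≤ 1`.

Finally, a `1/200`-net of the unit sphere over `T` has at most `401 ^ min k N` points
(`exists_net_sphere`), control on the net extends to the whole sphere (`bounds_of_net`), and the
number of pairs of a column set and a net point is at most
`N ^ min k N * 401 ^ min k N ≤ exp (15 * k * log N + 7)`, which is `exp (o(M))` by hypothesis. -/

/-! ### Nets of the unit sphere -/

/-- Volume bound for a `δ`-separated subset of the unit sphere: the balls of radius `δ / 2` around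
its points are disjoint and lie in the ball of radius `1 + δ / 2`. -/
theorem card_le_of_separated_sphere {E : Type*} [NormedAddCommGroup E] [NormedSpace ℝ E]
    [FiniteDimensional ℝ E] {δ : ℝ} (hδ : 0 < δ) (s : Finset E) (hs : ∀ c ∈ s, ‖c‖ = 1)
    (h : ∀ c ∈ s, ∀ d ∈ s, c ≠ d → δ ≤ ‖c - d‖) :
    (s.card : ℝ) ≤ (1 + 2 / δ) ^ Module.finrank ℝ E := by
  borelize E
  let μ : Measure E := Measure.addHaar
  have hδ2 : 0 < δ / 2 := by positivity
  have hρ : 0 < 1 + δ / 2 := by positivity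
  have D : Set.Pairwise (s : Set E) (Function.onFun Disjoint fun c => Metric.ball c (δ / 2)) := by
    rintro c hc d hd hcd
    apply Metric.ball_disjoint_ball
    rw [dist_eq_norm]
    linarith [h c hc d hd hcd]
  have hsub : (⋃ c ∈ s, Metric.ball c (δ / 2)) ⊆ Metric.ball (0 : E) (1 + δ / 2) := by
    refine Set.iUnion₂_subset fun x hx => Metric.ball_subset_ball' ?_
    rw [dist_zero_right, hs x hx, add_comm]
  have I : (s.card : ENNReal) * ENNReal.ofReal ((δ / 2) ^ Module.finrank ℝ E) *
        μ (Metric.ball 0 1) ≤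
      ENNReal.ofReal ((1 + δ / 2) ^ Module.finrank ℝ E) * μ (Metric.ball 0 1) := by
    rw [← μ.addHaar_ball_of_pos _ hρ]
    refine le_trans (le_of_eq ?_) (measure_mono hsub)
    rw [measure_biUnion_finset D fun c _ => measurableSet_ball]
    simp only [μ.addHaar_ball_of_pos _ hδ2, Finset.sum_const, nsmul_eq_mul, mul_assoc]
  have J := (ENNReal.mul_le_mul_iff_left (Metric.measure_ball_pos _ _ zero_lt_one).ne'
    measure_ball_lt_top.ne).1 I
  have K := ENNReal.toReal_le_of_le_ofReal (by positivity) J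
  rw [ENNReal.toReal_mul, ENNReal.toReal_natCast, ENNReal.toReal_ofReal (by positivity),
    ← le_div_iff₀ (by positivity), ← div_pow] at K
  have hq : (1 + δ / 2) / (δ / 2) = 1 + 2 / δ := by
    field_simp
    ring
  rwa [hq] at K

/-- The unit sphere of a `d`-dimensional space has a `δ`-net with at most `(1 + 2 / δ) ^ d`
points: a separated subset of maximal cardinality is one. -/
theorem exists_net_sphere (E : Type*) [NormedAddCommGroup E] [NormedSpace ℝ E]
    [FiniteDimensional ℝ E] {δ : ℝ} (hδ : 0 < δ) :
    ∃ A : Finset E, (∀ y ∈ A, ‖y‖ = 1) ∧ (A.card : ℝ) ≤ (1 + 2 / δ) ^ Module.finrank ℝ E ∧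
      ∀ x : E, ‖x‖ = 1 → ∃ y ∈ A, ‖x - y‖ ≤ δ := by
  classical
  let S : Set ℕ := {n | ∃ s : Finset E, s.card = n ∧ (∀ c ∈ s, ‖c‖ = 1) ∧
    ∀ c ∈ s, ∀ d ∈ s, c ≠ d → δ ≤ ‖c - d‖}
  have hne : S.Nonempty := ⟨0, ∅, by simp⟩
  have hbdd : BddAbove S := by
    refine ⟨⌊(1 + 2 / δ) ^ Module.finrank ℝ E⌋₊, ?_⟩
    rintro _ ⟨s, rfl, h1, h2⟩
    exact Nat.le_floor (card_le_of_separated_sphere hδ s h1 h2)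
  obtain ⟨A, hA, h1, h2⟩ := Nat.sSup_mem hne hbdd
  refine ⟨A, h1, card_le_of_separated_sphere hδ A h1 h2, fun x hx => ?_⟩
  by_contra! hfar
  have hxA : x ∉ A := fun hx' => by
    have := hfar x hx'
    simp only [sub_self, norm_zero] at this
    linarith
  have hmem : (insert x A).card ∈ S := by
    refine ⟨insert x A, rfl, ?_, ?_⟩
    · intro c hc
      rcases Finset.mem_insert.1 hc with rfl | hc
      exacts [hx, h1 c hc]
    · intro c hc d hd hcd
      rcases Finset.mem_insert.1 hc with rfl | hc' <;>
        rcases Finset.mem_insert.1 hd with rfl | hd'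
      · exact absurd rfl hcd
      · exact (hfar d hd').le
      · rw [norm_sub_rev]
        exact (hfar c hc').le
      · exact h2 c hc' d hd' hcd
  have := le_csSup hbdd hmem
  rw [Finset.card_insert_of_notMem hxA, ← hA] at this
  omega

/-- A bound for a linear map on a `δ`-net of the sphere bounds it on the whole space, with a loss
of the factor `1 / (1 - δ)`. -/
theorem norm_le_of_net {E F : Type*} [NormedAddCommGroup E] [NormedSpace ℝ E]
    [NormedAddCommGroup F] [NormedSpace ℝ F] (L : E →L[ℝ] F) {δ a : ℝ}
    (hδ1 : δ < 1) (ha : 0 ≤ a) {A : Finset E}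
    (hnet : ∀ x : E, ‖x‖ = 1 → ∃ y ∈ A, ‖x - y‖ ≤ δ) (hA : ∀ y ∈ A, ‖L y‖ ≤ a) :
    ‖L‖ ≤ a / (1 - δ) := by
  have hδ' : 0 < 1 - δ := by linarith
  by_cases hE : Subsingleton E
  · have : L = 0 := by ext x; simp [Subsingleton.elim x 0]
    rw [this, norm_zero]
    positivity
  rw [not_subsingleton_iff_nontrivial] at hE
  obtain ⟨x₀, hx₀⟩ := exists_norm_eq E zero_le_one
  have hδ0 : 0 ≤ δ := by
    obtain ⟨y, -, hy⟩ := hnet x₀ hx₀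
    exact (norm_nonneg _).trans hy
  have key : ‖L‖ ≤ a + δ * ‖L‖ := by
    refine L.opNorm_le_of_unit_norm (by positivity) fun x hx => ?_
    obtain ⟨y, hy, hxy⟩ := hnet x hx
    calc ‖L x‖ = ‖L y + L (x - y)‖ := by rw [← map_add]; congr 2; abel
      _ ≤ ‖L y‖ + ‖L (x - y)‖ := norm_add_le _ _
      _ ≤ a + ‖L‖ * δ := by
        gcongr
        · exact hA y hy
        · exact (L.le_opNorm _).trans (by gcongr)
      _ = a + δ * ‖L‖ := by ring
  rw [le_div_iff₀ hδ']
  linarith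

/-- A lower bound for a linear map on a `δ`-net of the sphere extends to the whole space, with a
loss controlled by an upper bound for the operator norm. -/
theorem le_norm_of_net {E F : Type*} [NormedAddCommGroup E] [NormedSpace ℝ E]
    [NormedAddCommGroup F] [NormedSpace ℝ F] (L : E →L[ℝ] F) {δ K b : ℝ} (hK : ‖L‖ ≤ K)
    {A : Finset E} (hnet : ∀ x : E, ‖x‖ = 1 → ∃ y ∈ A, ‖x - y‖ ≤ δ)
    (hA : ∀ y ∈ A, b ≤ ‖L y‖) (x : E) : (b - K * δ) * ‖x‖ ≤ ‖L x‖ := by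
  rcases eq_or_ne x 0 with rfl | hx
  · simp
  have hx0 : 0 < ‖x‖ := norm_pos_iff.2 hx
  obtain ⟨y, hy, hxy⟩ := hnet (‖x‖⁻¹ • x) (norm_smul_inv_norm (𝕜 := ℝ) hx)
  have h1 : ‖L (y - ‖x‖⁻¹ • x)‖ ≤ K * δ := by
    rw [norm_sub_rev] at hxy
    refine (L.le_opNorm _).trans ?_
    have := (norm_nonneg L).trans hK
    gcongr
  have h2 : b ≤ ‖x‖⁻¹ * ‖L x‖ + K * δ := by
    calc b ≤ ‖L y‖ := hA y hy
      _ = ‖L (‖x‖⁻¹ • x) + L (y - ‖x‖⁻¹ • x)‖ := by rw [← map_add]; congr 2; abel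
      _ ≤ ‖L (‖x‖⁻¹ • x)‖ + ‖L (y - ‖x‖⁻¹ • x)‖ := norm_add_le _ _
      _ ≤ ‖x‖⁻¹ * ‖L x‖ + K * δ := by
        rw [map_smul, norm_smul, norm_inv, norm_norm]
        gcongr
  calc (b - K * δ) * ‖x‖ ≤ (‖x‖⁻¹ * ‖L x‖) * ‖x‖ := by gcongr; linarith
    _ = ‖L x‖ := by field_simp

/-! ### Gaussian rows and chi-square tails -/

/-- The rows of a finite matrix of independent random variables are independent. -/
theorem iIndepFun_rows {Ω ι κ : Type*} [MeasurableSpace Ω] {P : Measure Ω} [Finite ι] [Finite κ]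
    {X : ι → κ → Ω → ℝ} (mX : ∀ i j, AEMeasurable (X i j) P)
    (h : iIndepFun (fun (p : ι × κ) ω => X p.1 p.2 ω) P) :
    iIndepFun (fun i ω j => X i j ω) P := by
  have := h.isProbabilityMeasure
  have hp : ∀ i j, IsProbabilityMeasure (P.map (X i j)) :=
    fun i j => Measure.isProbabilityMeasure_map (mX i j)
  have hσ : iIndepFun (fun (p : (_ : ι) × κ) ω => X p.1 p.2 ω) P :=
    h.precomp (Equiv.sigmaEquivProd ι κ).injective
  have hrow : ∀ i, iIndepFun (X i) P := fun i =>
    h.precomp (g := fun j => (i, j)) fun a b hab => (Prod.mk.inj hab).2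
  have mrow : ∀ i, AEMeasurable (fun ω j => X i j ω) P := fun i => aemeasurable_pi_iff.2 (mX i)
  have mσ : AEMeasurable (fun ω (p : (_ : ι) × κ) => X p.1 p.2 ω) P :=
    aemeasurable_pi_iff.2 fun p => mX p.1 p.2
  rw [iIndepFun_iff_map_fun_eq_infinitePi_map₀' mrow]
  have e : (fun i => P.map (fun ω j => X i j ω)) =
      fun i => Measure.infinitePi fun j => P.map (X i j) := by
    funext i
    exact (hrow i).map_fun_eq_infinitePi_map₀' (mX i)
  have hl := hσ.map_fun_eq_infinitePi_map₀' fun p : (_ : ι) × κ => mX p.1 p.2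
  rw [e, ← Measure.infinitePi_map_piCurry (fun i j => P.map (X i j)), ← hl,
    AEMeasurable.map_map_of_aemeasurable (MeasurableEquiv.measurable _).aemeasurable mσ]
  rfl

/-- A unit linear combination of independent standard Gaussians is standard Gaussian. -/
theorem hasLaw_gaussian_sum_mul {Ω ι : Type*} [MeasurableSpace Ω] {P : Measure Ω} [Fintype ι]
    {X : ι → Ω → ℝ} (hX : ∀ i, HasLaw (X i) (gaussianReal 0 1) P) (h : iIndepFun X P)
    {w : ι → ℝ} (hw : ∑ i, w i ^ 2 = 1) :
    HasLaw (fun ω => ∑ i, X i ω * w i) (gaussianReal 0 1) P := by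
  have := h.isProbabilityMeasure
  have hY : ∀ i, HasLaw (fun ω => X i ω * w i) _ P := fun i => gaussianReal_mul_const (hX i) (w i)
  have hind : iIndepFun (fun i ω => X i ω * w i) P :=
    h.comp (fun i x => x * w i) fun i => by fun_prop
  have hm : AEMeasurable (fun ω => ∑ i, X i ω * w i) P :=
    Finset.aemeasurable_fun_sum _ fun i _ => (hY i).aemeasurable
  refine ⟨hm, ?_⟩
  have := Measure.isProbabilityMeasure_map hm
  refine Measure.ext_of_charFun ?_
  rw [hind.charFun_map_fun_sum_eq_prod fun i => (hY i).aemeasurable]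
  ext t
  simp only [Finset.prod_apply, (hY _).map_eq, charFun_gaussianReal]
  rw [← Complex.exp_sum]
  congr 1
  have hw' : ∑ i, (w i : ℂ) ^ 2 = 1 := by exact_mod_cast hw
  have hv : ∀ i, (((.mk (w i ^ 2) (sq_nonneg _) * 1 : NNReal) : ℝ) : ℂ) = (w i : ℂ) ^ 2 := by
    intro i
    rw [mul_one]
    exact Complex.ofReal_pow _ _
  simp only [hv, mul_zero, Complex.ofReal_zero, zero_mul, zero_sub, Finset.sum_neg_distrib,
    ← Finset.sum_div, ← Finset.sum_mul, hw', NNReal.coe_one, Complex.ofReal_one]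

/-- For `t ≥ 1 / 2` the function is not integrable and both sides are zero by convention. -/
theorem mgf_sq_gaussian {Ω : Type*} [MeasurableSpace Ω] {P : Measure Ω} {Z : Ω → ℝ}
    (hZ : HasLaw Z (gaussianReal 0 1) P) (t : ℝ) :
    mgf (fun ω => Z ω ^ 2) P t = (√(1 - 2 * t))⁻¹ := by
  have hc := hZ.integral_comp (f := fun z => Real.exp (t * z ^ 2)) (by fun_prop)
  simp only [Function.comp_def] at hc
  rw [mgf, hc, integral_gaussianReal_eq_integral_smul one_ne_zero]
  have : ∀ x : ℝ, gaussianPDFReal 0 1 x • Real.exp (t * x ^ 2) =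
      (√(2 * Real.pi))⁻¹ * Real.exp (-(1 / 2 - t) * x ^ 2) := by
    intro x
    rw [gaussianPDFReal, smul_eq_mul, mul_assoc, ← Real.exp_add]
    simp only [NNReal.coe_one, mul_one, sub_zero]
    congr 2
    ring
  simp_rw [this]
  rw [integral_const_mul, integral_gaussian, ← Real.sqrt_inv, ← Real.sqrt_inv,
    ← Real.sqrt_mul (by positivity)]
  congr 1
  have hπ := Real.pi_ne_zero
  rw [show 1 - 2 * t = 2 * (1 / 2 - t) by ring, mul_inv, mul_inv, div_eq_mul_inv]
  field_simp

theorem mgf_sum_sq_gaussian {Ω ι : Type*} [MeasurableSpace Ω] {P : Measure Ω}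
    {Z : ι → Ω → ℝ} (hZ : ∀ i, HasLaw (Z i) (gaussianReal 0 1) P) (h : iIndepFun Z P)
    (R : Finset ι) (t : ℝ) :
    mgf (fun ω => ∑ i ∈ R, Z i ω ^ 2) P t = (√(1 - 2 * t))⁻¹ ^ R.card := by
  have hind : iIndepFun (fun i ω => Z i ω ^ 2) P := h.comp (fun _ x => x ^ 2) fun i => by fun_prop
  have := hind.mgf_sum₀ (t := t) (fun i => (hZ i).aemeasurable.pow_const 2) R
  simp only [mgf_sq_gaussian (hZ _), Finset.prod_const] at this
  rw [← this]
  congr 1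
  ext ω
  simp

theorem integrable_exp_mul_sum_sq_gaussian {Ω ι : Type*} [MeasurableSpace Ω] {P : Measure Ω}
    {Z : ι → Ω → ℝ} (hZ : ∀ i, HasLaw (Z i) (gaussianReal 0 1) P) (h : iIndepFun Z P)
    (R : Finset ι) {t : ℝ} (ht : t < 1 / 2) :
    Integrable (fun ω => Real.exp (t * ∑ i ∈ R, Z i ω ^ 2)) P := by
  have h0 : mgf (fun ω => ∑ i ∈ R, Z i ω ^ 2) P t ≠ 0 := by
    rw [mgf_sum_sq_gaussian hZ h]
    have : 0 < 1 - 2 * t := by linarith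
    positivity
  -- A non-integrable function has integral zero by convention.
  exact Integrable.of_integral_ne_zero h0

/-- Form in which the numerical comparison of Chernoff exponents is checked: squaring removes the
square root of the moment generating function. -/
theorem sqrt_mul_exp_le {a r s : ℝ} (h : a ≤ Real.exp (2 * (s - r))) :
    Real.exp r * √a ≤ Real.exp s := by
  have : √a ≤ Real.exp (s - r) := by
    rw [Real.sqrt_le_left (Real.exp_pos _).le, ← Real.exp_nat_mul]
    exact_mod_cast h
  calc Real.exp r * √a ≤ Real.exp r * Real.exp (s - r) := by gcongr
    _ = Real.exp s := by rw [← Real.exp_add]; congr 1; ring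

/-- Upper tail of a chi-square variable with `|R|` degrees of freedom. -/
theorem chiSq_upper_tail {Ω ι : Type*} [MeasurableSpace Ω] {P : Measure Ω}
    {Z : ι → Ω → ℝ} (hZ : ∀ i, HasLaw (Z i) (gaussianReal 0 1) P) (h : iIndepFun Z P)
    (R : Finset ι) :
    P.real {ω | 11 / 10 * (R.card : ℝ) ≤ ∑ i ∈ R, Z i ω ^ 2} ≤
      Real.exp (-(1 / 500) * R.card) := by
  have := h.isProbabilityMeasure
  -- `t = 1 / 22` minimizes the bound at the threshold `11 / 10`: there `1 - 2 * t = 10 / 11`.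
  refine (measure_ge_le_exp_mul_mgf _ (t := 1 / 22) (by norm_num)
    (integrable_exp_mul_sum_sq_gaussian hZ h R (by norm_num))).trans ?_
  rw [mgf_sum_sq_gaussian hZ h, ← Real.sqrt_inv]
  have e1 : Real.exp (-(1 / 22) * (11 / 10 * (R.card : ℝ))) =
      Real.exp (-(1 / 20)) ^ R.card := by
    rw [← Real.exp_nat_mul]; congr 1; ring
  have e2 : Real.exp (-(1 / 500) * (R.card : ℝ)) = Real.exp (-(1 / 500)) ^ R.card := by
    rw [← Real.exp_nat_mul]; congr 1; ring
  rw [e1, e2, ← mul_pow]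
  gcongr
  refine sqrt_mul_exp_le ?_
  have := Real.quadratic_le_exp_of_nonneg (x := 2 * (-(1 / 500) - -(1 / 20))) (by norm_num)
  norm_num at this ⊢
  linarith

/-- Lower tail of a chi-square variable with `|R|` degrees of freedom. -/
theorem chiSq_lower_tail {Ω ι : Type*} [MeasurableSpace Ω] {P : Measure Ω}
    {Z : ι → Ω → ℝ} (hZ : ∀ i, HasLaw (Z i) (gaussianReal 0 1) P) (h : iIndepFun Z P)
    (R : Finset ι) :
    P.real {ω | ∑ i ∈ R, Z i ω ^ 2 ≤ 9 / 10 * (R.card : ℝ)} ≤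
      Real.exp (-(1 / 500) * R.card) := by
  have := h.isProbabilityMeasure
  -- `t = -1 / 18` minimizes the bound at the threshold `9 / 10`: there `1 - 2 * t = 10 / 9`.
  refine (measure_le_le_exp_mul_mgf _ (t := -(1 / 18)) (by norm_num)
    (integrable_exp_mul_sum_sq_gaussian hZ h R (by norm_num))).trans ?_
  rw [mgf_sum_sq_gaussian hZ h, ← Real.sqrt_inv]
  have e1 : Real.exp (-(-(1 / 18)) * (9 / 10 * (R.card : ℝ))) =
      Real.exp (1 / 20) ^ R.card := by
    rw [← Real.exp_nat_mul]; congr 1; ring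
  have e2 : Real.exp (-(1 / 500) * (R.card : ℝ)) = Real.exp (-(1 / 500)) ^ R.card := by
    rw [← Real.exp_nat_mul]; congr 1; ring
  rw [e1, e2, ← mul_pow]
  gcongr
  refine sqrt_mul_exp_le ?_
  -- The required `9 / 10 ≤ exp (-13 / 125)` is tight; it follows from
  -- `exp (-13 / 1000) ≥ 1 - 13 / 1000` by taking eighth powers.
  have h1 := Real.add_one_le_exp (-(13 / 1000) : ℝ)
  have h2 : Real.exp (2 * (-(1 / 500) - 1 / 20)) = Real.exp (-(13 / 1000)) ^ 8 := by
    rw [← Real.exp_nat_mul]; norm_num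
  rw [h2]
  refine le_trans ?_ (pow_le_pow_left₀ (by norm_num) h1 8)
  norm_num

/-! ### Reduction of `ρ⁻` and `ρ⁺` to column sets of maximal size -/

theorem norm_sq_toEuclideanLin {m ι : Type*} [Fintype m] [Fintype ι] [DecidableEq ι]
    (A : Matrix m ι ℝ) (x : EuclideanSpace ℝ ι) :
    ‖Matrix.toEuclideanLin A x‖ ^ 2 = ∑ i, (∑ j, A i j * x j) ^ 2 := by
  rw [EuclideanSpace.norm_sq_eq]
  simp [Matrix.toLpLin_apply, Matrix.mulVec, dotProduct]

theorem norm_sq_toEuclideanLin_rowSub {m ι : Type*} [Fintype ι] [DecidableEq ι]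
    (A : Matrix m ι ℝ) (R : Finset m) (x : EuclideanSpace ℝ ι) :
    ‖Matrix.toEuclideanLin (rowSub A R) x‖ ^ 2 = ∑ i ∈ R, (∑ j, A i j * x j) ^ 2 := by
  rw [norm_sq_toEuclideanLin, ← Finset.sum_coe_sort R]
  rfl

theorem norm_toEuclideanLin_rowSub_univ {m ι : Type*} [Fintype m] [Fintype ι] [DecidableEq ι]
    (A : Matrix m ι ℝ) (x : EuclideanSpace ℝ ι) :
    ‖Matrix.toEuclideanLin (rowSub A Finset.univ) x‖ = ‖Matrix.toEuclideanLin A x‖ := by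
  rw [← sq_eq_sq₀ (norm_nonneg _) (norm_nonneg _), norm_sq_toEuclideanLin_rowSub,
    norm_sq_toEuclideanLin]

/-- Extending a vector by zero shows that every restricted quotient is attained on a column set
with exactly `min k |n|` elements. -/
theorem exists_of_mem_restrictedQuotients {m n : Type*} [Fintype m] [Fintype n] [DecidableEq n]
    {k : ℕ} {Ψ : Matrix m n ℝ} {r : ℝ} (hr : r ∈ restrictedQuotients k Ψ) :
    ∃ (T : Finset n) (w : EuclideanSpace ℝ T), T.card = min k (Fintype.card n) ∧ w ≠ 0 ∧
      r = ‖Matrix.toEuclideanLin (colSub Ψ T) w‖ ^ 2 / ‖w‖ ^ 2 := by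
  obtain ⟨T, h, hT, hne, rfl⟩ := hr
  obtain ⟨T', hTT', -, hT'⟩ := Finset.exists_subsuperset_card_eq (Finset.subset_univ T)
    (n := min k (Fintype.card n)) (le_min hT (Finset.card_le_univ T)) (by simp)
  let g : n → ℝ := fun j => if j ∈ T then h j else 0
  have hsum : ∀ f : n → ℝ, ∑ j : T', f j * g j = ∑ j : T, f j * h j := by
    intro f
    rw [Finset.sum_coe_sort T' fun j => f j * g j, Finset.sum_coe_sort T fun j => f j * h j,
      ← Finset.sum_subset hTT' fun j _ hj => by simp [g, hj]]
    exact Finset.sum_congr rfl fun j hj => by simp [g, hj]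
  have hnorm : ‖WithLp.toLp 2 (T'.restrict g)‖ ^ 2 = ‖WithLp.toLp 2 (T.restrict h)‖ ^ 2 := by
    rw [EuclideanSpace.norm_sq_eq, EuclideanSpace.norm_sq_eq]
    simp only [Finset.restrict, Real.norm_eq_abs, sq_abs]
    have := hsum g
    simp only [← sq] at this
    rw [this]
    refine Finset.sum_congr rfl fun j _ => ?_
    simp [g, sq]
  refine ⟨T', WithLp.toLp 2 (T'.restrict g), hT', fun h0 => hne ?_, ?_⟩
  · rw [h0, norm_zero, zero_pow two_ne_zero, eq_comm, sq_eq_zero_iff, norm_eq_zero] at hnorm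
    simpa using hnorm
  · rw [hnorm, norm_sq_toEuclideanLin, EuclideanSpace.norm_sq_eq]
    congr 1
    refine Finset.sum_congr rfl fun i _ => ?_
    rw [Real.norm_eq_abs, sq_abs]
    congr 1
    exact (hsum fun j => Ψ i j).symm

theorem sqrt_rhoPlus_le {m n : Type*} [Fintype m] [Fintype n] [DecidableEq n] {k : ℕ}
    {Ψ : Matrix m n ℝ} {a : ℝ} (ha : 0 ≤ a)
    (h : ∀ T : Finset n, T.card = min k (Fintype.card n) → ∀ w : EuclideanSpace ℝ T,
      ‖Matrix.toEuclideanLin (colSub Ψ T) w‖ ≤ a * ‖w‖) :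
    √(rhoPlus k Ψ) ≤ a := by
  rw [Real.sqrt_le_left ha]
  refine Real.sSup_le (fun r hr => ?_) (by positivity)
  obtain ⟨T, w, hT, hw, rfl⟩ := exists_of_mem_restrictedQuotients hr
  have hw' := norm_pos_iff.2 hw
  rw [div_le_iff₀ (by positivity), ← mul_pow]
  exact pow_le_pow_left₀ (norm_nonneg _) (h T hT w) 2

theorem le_sqrt_rhoMinus {m n : Type*} [Fintype m] [Fintype n] [DecidableEq n] [Nonempty n]
    {k : ℕ} (hk : 1 ≤ k) {Ψ : Matrix m n ℝ} {b : ℝ} (hb : 0 ≤ b)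
    (h : ∀ T : Finset n, T.card = min k (Fintype.card n) → ∀ w : EuclideanSpace ℝ T,
      b * ‖w‖ ≤ ‖Matrix.toEuclideanLin (colSub Ψ T) w‖) :
    b ≤ √(rhoMinus k Ψ) := by
  refine Real.le_sqrt_of_sq_le (le_csInf (restrictedQuotients_nonempty hk Ψ) fun r hr => ?_)
  obtain ⟨T, w, hT, hw, rfl⟩ := exists_of_mem_restrictedQuotients hr
  have hw' := norm_pos_iff.2 hw
  rw [le_div_iff₀ (by positivity), ← mul_pow]
  exact pow_le_pow_left₀ (by positivity) (h T hT w) 2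

/-! ### From a net to all vectors and all large row sets -/

/-- If the squared norms of `A y` are controlled from above on a `1/200`-net, and those of its
restriction to a large row set `R` from below, then the row submatrix satisfies both bounds for
all vectors. Its upper bound is inherited from `A`, since deleting rows decreases the norm. -/
theorem bounds_of_net {m ι : Type*} [Fintype m] [Fintype ι] [DecidableEq ι]
    {A : Matrix m ι ℝ} {S : Finset (EuclideanSpace ℝ ι)}
    (hnet : ∀ x : EuclideanSpace ℝ ι, ‖x‖ = 1 → ∃ y ∈ S, ‖x - y‖ ≤ 1 / 200)
    (hup : ∀ y ∈ S, ∑ i, (∑ j, A i j * y j) ^ 2 ≤ 11 / 10 * (Fintype.card m : ℝ))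
    {R : Finset m} (hR : 9999 / 10000 * (Fintype.card m : ℝ) ≤ R.card)
    (hlow : ∀ y ∈ S, 9 / 10 * (R.card : ℝ) ≤ ∑ i ∈ R, (∑ j, A i j * y j) ^ 2)
    (x : EuclideanSpace ℝ ι) :
    ‖Matrix.toEuclideanLin (rowSub A R) x‖ ≤ 17 / 16 * √(R.card : ℝ) * ‖x‖ ∧
      15 / 16 * √(R.card : ℝ) * ‖x‖ ≤ ‖Matrix.toEuclideanLin (rowSub A R) x‖ := by
  set ρ := √(R.card : ℝ) with hρ
  have hρ0 : 0 ≤ ρ := Real.sqrt_nonneg _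
  have hρ2 : ρ ^ 2 = R.card := Real.sq_sqrt (Nat.cast_nonneg _)
  let L := (Matrix.toEuclideanLin (rowSub A R)).toContinuousLinearMap
  have hL1 : ∀ y ∈ S, ‖L y‖ ≤ 21 / 20 * ρ := by
    intro y hy
    refine le_of_sq_le_sq ?_ (by positivity)
    calc ‖L y‖ ^ 2 = ∑ i ∈ R, (∑ j, A i j * y j) ^ 2 := norm_sq_toEuclideanLin_rowSub A R y
      _ ≤ ∑ i, (∑ j, A i j * y j) ^ 2 :=
        Finset.sum_le_sum_of_subset_of_nonneg (Finset.subset_univ R) fun _ _ _ => sq_nonneg _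
      _ ≤ 11 / 10 * (Fintype.card m : ℝ) := hup y hy
      _ ≤ (21 / 20 * ρ) ^ 2 := by rw [mul_pow, hρ2]; linarith
  have hL : ‖L‖ ≤ 17 / 16 * ρ := by
    refine (norm_le_of_net L (by norm_num) (by positivity) hnet hL1).trans ?_
    rw [div_le_iff₀ (by norm_num)]
    linarith
  have hL2 : ∀ y ∈ S, 948 / 1000 * ρ ≤ ‖L y‖ := by
    intro y hy
    refine le_of_sq_le_sq ?_ (norm_nonneg _)
    calc (948 / 1000 * ρ) ^ 2 ≤ 9 / 10 * (R.card : ℝ) := by rw [mul_pow, hρ2]; linarith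
      _ ≤ ∑ i ∈ R, (∑ j, A i j * y j) ^ 2 := hlow y hy
      _ = ‖L y‖ ^ 2 := (norm_sq_toEuclideanLin_rowSub A R y).symm
  refine ⟨(L.le_opNorm x).trans (by gcongr), ?_⟩
  refine le_trans ?_ (le_norm_of_net L hL hnet hL2 x)
  gcongr
  linarith

/-! ### The union bound -/

/-- The number of subsets missing at most a proportion `1/10000` of the elements, bounded by
comparing with the binomial sum `∑ R, b ^ (M - |R|) = (1 + b) ^ M` at `b = exp (-10)`. -/
theorem card_large_finsets_le (M : ℕ) :
    (((Finset.univ : Finset (Finset (Fin M))).filter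
      fun R => 9999 / 10000 * (M : ℝ) ≤ R.card).card : ℝ) ≤ Real.exp (11 / 10000 * M) := by
  set F := (Finset.univ : Finset (Finset (Fin M))).filter
    fun R => 9999 / 10000 * (M : ℝ) ≤ R.card
  have hexp : Real.exp (-10) ≤ 1 / 10000 := by
    have h1 := Real.exp_one_gt_d9
    have h2 : Real.exp 10 = Real.exp 1 ^ 10 := by rw [← Real.exp_nat_mul]; norm_num
    have h3 : (10000 : ℝ) ≤ Real.exp 10 := by
      rw [h2]
      exact le_trans (by norm_num) (pow_le_pow_left₀ (by norm_num) h1.le 10)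
    rw [Real.exp_neg, ← one_div]
    exact one_div_le_one_div_of_le (by norm_num) h3
  have hsum : (F.card : ℝ) * Real.exp (-(1 / 1000) * M) ≤ Real.exp (1 / 10000 * M) := by
    calc (F.card : ℝ) * Real.exp (-(1 / 1000) * M)
        = ∑ R ∈ F, Real.exp (-(1 / 1000) * M) := by rw [Finset.sum_const, nsmul_eq_mul]
      _ ≤ ∑ R ∈ F, 1 ^ R.card * Real.exp (-10) ^ (M - R.card) := by
        refine Finset.sum_le_sum fun R hR => ?_
        have hR' := (Finset.mem_filter.1 hR).2
        have hc : R.card ≤ M := by simpa using Finset.card_le_univ R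
        rw [one_pow, one_mul, ← Real.exp_nat_mul, Nat.cast_sub hc]
        exact Real.exp_le_exp.2 (by linarith)
      _ ≤ ∑ R : Finset (Fin M), 1 ^ R.card * Real.exp (-10) ^ (M - R.card) :=
        Finset.sum_le_sum_of_subset_of_nonneg (Finset.subset_univ F)
          fun _ _ _ => by positivity
      _ = (1 + Real.exp (-10)) ^ M := Fin.sum_pow_mul_eq_add_pow 1 (Real.exp (-10))
      _ ≤ Real.exp (1 / 10000) ^ M := by
        gcongr
        linarith [Real.add_one_le_exp (1 / 10000 : ℝ)]
      _ = Real.exp (1 / 10000 * M) := by rw [← Real.exp_nat_mul]; congr 1; ring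
  calc (F.card : ℝ)
      = F.card * Real.exp (-(1 / 1000) * M) * Real.exp (1 / 1000 * M) := by
        rw [mul_assoc, ← Real.exp_add]; simp
    _ ≤ Real.exp (1 / 10000 * M) * Real.exp (1 / 1000 * M) := by gcongr
    _ = Real.exp (11 / 10000 * M) := by rw [← Real.exp_add]; congr 1; ring

section
variable {Ω : Type*} [MeasurableSpace Ω] {P : Measure Ω} {M N : ℕ}
  {Φ : Ω → Matrix (Fin M) (Fin N) ℝ}

theorem IsGaussianMatrix.hasLaw_mulVec (hΦ : IsGaussianMatrix P Φ) {T : Finset (Fin N)}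
    {y : EuclideanSpace ℝ T} (hy : ‖y‖ = 1) (i : Fin M) :
    HasLaw (fun ω => ∑ j, colSub (Φ ω) T i j * y j) (gaussianReal 0 1) P := by
  refine hasLaw_gaussian_sum_mul (X := fun (j : T) ω => Φ ω i j) (fun j => hΦ.hasLaw i j)
    (hΦ.indep.precomp (g := fun j : T => (i, (j : Fin N))) fun a b hab =>
      Subtype.ext (Prod.mk.inj hab).2) ?_
  have := EuclideanSpace.norm_sq_eq y
  rw [hy] at this
  simpa using this.symm

theorem IsGaussianMatrix.iIndepFun_mulVec (hΦ : IsGaussianMatrix P Φ) {T : Finset (Fin N)}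
    (y : EuclideanSpace ℝ T) :
    iIndepFun (fun (i : Fin M) ω => ∑ j, colSub (Φ ω) T i j * y j) P :=
  (iIndepFun_rows (X := fun i j ω => Φ ω i j) (fun i j => (hΦ.hasLaw i j).aemeasurable)
    hΦ.indep).comp (fun _ r => ∑ j : T, r j * y j) fun i => by fun_prop

/-- For one unit vector `y`, except with exponentially small probability `Φ_T y` has no large norm,
and no restriction of it to a large set of rows has a small norm. -/
theorem IsGaussianMatrix.prob_bad_vector_le (hΦ : IsGaussianMatrix P Φ) {T : Finset (Fin N)}
    {y : EuclideanSpace ℝ T} (hy : ‖y‖ = 1) :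
    P.real {ω | 11 / 10 * (M : ℝ) ≤ ∑ i, (∑ j, colSub (Φ ω) T i j * y j) ^ 2 ∨
      ∃ R : Finset (Fin M), 9999 / 10000 * (M : ℝ) ≤ R.card ∧
        ∑ i ∈ R, (∑ j, colSub (Φ ω) T i j * y j) ^ 2 ≤ 9 / 10 * (R.card : ℝ)} ≤
      2 * Real.exp (-(8 / 10000) * M) := by
  have := hΦ.indep.isProbabilityMeasure
  set F := (Finset.univ : Finset (Finset (Fin M))).filter
    fun R => 9999 / 10000 * (M : ℝ) ≤ R.card
  let U : Set Ω := {ω | 11 / 10 * (M : ℝ) ≤ ∑ i, (∑ j, colSub (Φ ω) T i j * y j) ^ 2}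
  let V : Finset (Fin M) → Set Ω := fun R =>
    {ω | ∑ i ∈ R, (∑ j, colSub (Φ ω) T i j * y j) ^ 2 ≤ 9 / 10 * (R.card : ℝ)}
  have hU : P.real U ≤ Real.exp (-(8 / 10000) * M) := by
    have := chiSq_upper_tail (hΦ.hasLaw_mulVec hy) (hΦ.iIndepFun_mulVec y) Finset.univ
    rw [Finset.card_univ, Fintype.card_fin] at this
    refine this.trans (Real.exp_le_exp.2 ?_)
    linarith [(Nat.cast_nonneg M : (0 : ℝ) ≤ M)]
  have hV : P.real (⋃ R ∈ F, V R) ≤ Real.exp (-(8 / 10000) * M) := by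
    calc P.real (⋃ R ∈ F, V R) ≤ ∑ R ∈ F, P.real (V R) := measureReal_biUnion_finset_le _ _
      _ ≤ ∑ R ∈ F, Real.exp (-(19 / 10000) * M) := by
        refine Finset.sum_le_sum fun R hR => ?_
        refine (chiSq_lower_tail (hΦ.hasLaw_mulVec hy) (hΦ.iIndepFun_mulVec y) R).trans
          (Real.exp_le_exp.2 ?_)
        have hR' := (Finset.mem_filter.1 hR).2
        have hM : (0 : ℝ) ≤ M := Nat.cast_nonneg _
        linarith
      _ = F.card * Real.exp (-(19 / 10000) * M) := by rw [Finset.sum_const, nsmul_eq_mul]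
      _ ≤ Real.exp (11 / 10000 * M) * Real.exp (-(19 / 10000) * M) := by
        gcongr
        exact card_large_finsets_le M
      _ = Real.exp (-(8 / 10000) * M) := by rw [← Real.exp_add]; congr 1; ring
  calc _ ≤ P.real (U ∪ ⋃ R ∈ F, V R) := by
        refine measureReal_mono ?_
        rintro ω (h | ⟨R, hR, h⟩)
        · exact Or.inl h
        · exact Or.inr (Set.mem_biUnion (Finset.mem_filter.2 ⟨Finset.mem_univ R, hR⟩) h)
    _ ≤ P.real U + P.real (⋃ R ∈ F, V R) := measureReal_union_le _ _
    _ ≤ 2 * Real.exp (-(8 / 10000) * M) := by linarith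

/-- All large row submatrices of `Φ` satisfy both restricted bounds, except on an event whose
probability is controlled by a union bound over the column sets of size `min k N` and over nets
of their unit spheres. -/
theorem IsGaussianMatrix.prob_bad_matrix_le (hΦ : IsGaussianMatrix P Φ) (k : ℕ) :
    P.real {ω | ¬ ∀ R : Finset (Fin M), 9999 / 10000 * (M : ℝ) ≤ R.card →
      ∀ T : Finset (Fin N), T.card = min k N → ∀ x : EuclideanSpace ℝ T,
        ‖Matrix.toEuclideanLin (rowSub (colSub (Φ ω) T) R) x‖ ≤
            17 / 16 * √(R.card : ℝ) * ‖x‖ ∧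
          15 / 16 * √(R.card : ℝ) * ‖x‖ ≤
            ‖Matrix.toEuclideanLin (rowSub (colSub (Φ ω) T) R) x‖} ≤
      (N : ℝ) ^ min k N * 401 ^ min k N * (2 * Real.exp (-(8 / 10000) * M)) := by
  have := hΦ.indep.isProbabilityMeasure
  choose S hS1 hScard hSnet using fun T : Finset (Fin N) =>
    exists_net_sphere (EuclideanSpace ℝ T) (δ := 1 / 200) (by norm_num)
  let W : (T : Finset (Fin N)) → EuclideanSpace ℝ T → Set Ω := fun T y =>
    {ω | 11 / 10 * (M : ℝ) ≤ ∑ i, (∑ j, colSub (Φ ω) T i j * y j) ^ 2 ∨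
      ∃ R : Finset (Fin M), 9999 / 10000 * (M : ℝ) ≤ R.card ∧
        ∑ i ∈ R, (∑ j, colSub (Φ ω) T i j * y j) ^ 2 ≤ 9 / 10 * (R.card : ℝ)}
  let G := Finset.powersetCard (min k N) (Finset.univ : Finset (Fin N))
  calc _ ≤ P.real (⋃ T ∈ G, ⋃ y ∈ S T, W T y) := by
        refine measureReal_mono (fun ω hω => ?_) (measure_ne_top _ _)
        by_contra hgood
        refine hω fun R hR T hT x => ?_
        have hW : ∀ y ∈ S T, ω ∉ W T y := fun y hy hmem => hgood
          (Set.mem_biUnion (Finset.mem_powersetCard.2 ⟨Finset.subset_univ T, hT⟩)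
            (Set.mem_biUnion hy hmem))
        refine bounds_of_net (hSnet T) (fun y hy => ?_) (by simpa using hR) (fun y hy => ?_) x
        · have h1 := hW y hy
          simp only [W, Set.mem_ofPred_eq, not_or, not_le] at h1
          simpa using h1.1.le
        · have h1 := hW y hy
          simp only [W, Set.mem_ofPred_eq, not_or, not_exists, not_and, not_le] at h1
          exact (h1.2 R hR).le
    _ ≤ ∑ T ∈ G, P.real (⋃ y ∈ S T, W T y) := measureReal_biUnion_finset_le _ _
    _ ≤ ∑ T ∈ G, 401 ^ min k N * (2 * Real.exp (-(8 / 10000) * M)) := by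
        refine Finset.sum_le_sum fun T hT => ?_
        have hTc := (Finset.mem_powersetCard.1 hT).2
        have hc := hScard T
        rw [finrank_euclideanSpace, Fintype.card_coe, hTc] at hc
        norm_num at hc
        calc P.real (⋃ y ∈ S T, W T y) ≤ ∑ y ∈ S T, P.real (W T y) :=
              measureReal_biUnion_finset_le _ _
          _ ≤ ∑ y ∈ S T, 2 * Real.exp (-(8 / 10000) * M) :=
              Finset.sum_le_sum fun y hy => hΦ.prob_bad_vector_le (hS1 T y hy)
          _ ≤ 401 ^ min k N * (2 * Real.exp (-(8 / 10000) * M)) := by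
              rw [Finset.sum_const, nsmul_eq_mul]
              gcongr
    _ = (N.choose (min k N) : ℝ) * (401 ^ min k N * (2 * Real.exp (-(8 / 10000) * M))) := by
        rw [Finset.sum_const, nsmul_eq_mul, Finset.card_powersetCard, Finset.card_univ,
          Fintype.card_fin]
    _ ≤ _ := by
        rw [← mul_assoc]
        gcongr
        exact_mod_cast Nat.choose_le_pow N (min k N)

end

/-- The number of column sets times the size of a net. Where `N = 1` the logarithm vanishes and
`min k N = 1`; this is the reason for the additive constant. -/
theorem pow_min_mul_pow_min_le {k N : ℕ} (hN : 1 ≤ N) (hk : 1 ≤ k) :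
    (N : ℝ) ^ min k N * 401 ^ min k N ≤ Real.exp (15 * (k * Real.log N) + 7) := by
  have hN0 : (0 : ℝ) < N := by exact_mod_cast hN
  have hlog : 0 ≤ Real.log N := Real.log_natCast_nonneg N
  have hk0 : (0 : ℝ) ≤ k := Nat.cast_nonneg k
  have hmk : ((min k N : ℕ) : ℝ) ≤ k := by exact_mod_cast min_le_left k N
  have hmin : ((min k N : ℕ) : ℝ) ≤ 1 + 2 * (k * Real.log N) := by
    rcases hN.eq_or_lt with rfl | hN2
    · simp [hk]
    · have h2 : Real.log 2 ≤ Real.log N :=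
        Real.log_le_log (by norm_num) (by exact_mod_cast hN2)
      have := Real.log_two_gt_d9
      nlinarith
  have h401 : (401 : ℝ) ≤ Real.exp 7 := by
    have h1 := Real.exp_one_gt_d9
    have h2 : Real.exp 7 = Real.exp 1 ^ 7 := by rw [← Real.exp_nat_mul]; norm_num
    rw [h2]
    exact le_trans (by norm_num) (pow_le_pow_left₀ (by norm_num) h1.le 7)
  calc (N : ℝ) ^ min k N * 401 ^ min k N
      ≤ Real.exp (Real.log N) ^ min k N * Real.exp 7 ^ min k N := by
        rw [Real.exp_log hN0]
        gcongr
    _ = Real.exp ((min k N : ℕ) * Real.log N + (min k N : ℕ) * 7) := by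
        rw [← Real.exp_nat_mul, ← Real.exp_nat_mul, ← Real.exp_add]
    _ ≤ Real.exp (15 * (k * Real.log N) + 7) := by
        exact Real.exp_le_exp.2 (by nlinarith)

/-! ### Asymptotics of the failure probability -/

theorem theorem3 :
    ∃ τ c C : ℝ, 0 < τ ∧ 0 < c ∧ 0 < C ∧
      ∀ M N k : ℕ → ℕ,
        Tendsto M atTop atTop → (∀ n, 1 ≤ N n) → (∀ n, 1 ≤ k n) →
        (fun n => (k n : ℝ) * Real.log (N n)) =o[atTop] (fun n => (M n : ℝ)) →
        ∃ e : ℕ → ℝ, e =o[atTop] (fun n => √(M n : ℝ)) ∧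
          ∀ᶠ n in atTop,
            ∀ (Ω : Type*) [MeasurableSpace Ω] (P : Measure Ω) [IsProbabilityMeasure P]
              (Φ : Ω → Matrix (Fin (M n)) (Fin (N n)) ℝ), IsGaussianMatrix P Φ →
              1 - C * Real.exp (-(c * (M n : ℝ))) <
                P.real {ω |
                  √(rhoPlus (k n) (Φ ω)) ≤ 17 / 16 * √(M n : ℝ) + e n ∧
                  15 / 16 * √(M n : ℝ) - e n ≤ √(rhoMinus (k n) (Φ ω)) ∧
                  ∀ (R : Finset (Fin (M n))) (χ : ℝ),
                    χ = ((M n : ℝ) - (R.card : ℝ)) / (M n : ℝ) →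
                    χ * (1 - Real.log χ) ≤ τ →
                      √(rhoPlus (k n) (rowSub (Φ ω) R)) ≤
                          17 / 16 * √(R.card : ℝ) + e n ∧
                      15 / 16 * √(R.card : ℝ) - e n ≤
                          √(rhoMinus (k n) (rowSub (Φ ω) R))} := by
  refine ⟨1 / 10000, 1 / 2000, 3, by norm_num, by norm_num, by norm_num, ?_⟩
  intro M N k hM hN hk ho
  refine ⟨fun _ => 0, isLittleO_zero _ _, ?_⟩
  filter_upwards [ho.bound (by norm_num : (0 : ℝ) < 1 / 100000),
    hM.eventually_ge_atTop 70000] with n hn hMn Ω _ P _ Φ hΦ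
  have hMn' : (70000 : ℝ) ≤ M n := by exact_mod_cast hMn
  have : Nonempty (Fin (N n)) := ⟨⟨0, hN n⟩⟩
  rw [Real.norm_of_nonneg (mul_nonneg (Nat.cast_nonneg _) (Real.log_natCast_nonneg _)),
    Real.norm_of_nonneg (Nat.cast_nonneg _)] at hn
  have hbad := hΦ.prob_bad_matrix_le (k n)
  set B : Set Ω := {ω | ¬ ∀ R : Finset (Fin (M n)), 9999 / 10000 * (M n : ℝ) ≤ R.card →
      ∀ T : Finset (Fin (N n)), T.card = min (k n) (N n) → ∀ x : EuclideanSpace ℝ T,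
        ‖Matrix.toEuclideanLin (rowSub (colSub (Φ ω) T) R) x‖ ≤
            17 / 16 * √(R.card : ℝ) * ‖x‖ ∧
          15 / 16 * √(R.card : ℝ) * ‖x‖ ≤
            ‖Matrix.toEuclideanLin (rowSub (colSub (Φ ω) T) R) x‖}
  have hB : P.real B < 3 * Real.exp (-(1 / 2000 * (M n : ℝ))) := by
    calc P.real B ≤ Real.exp (15 * (k n * Real.log (N n)) + 7) *
          (2 * Real.exp (-(8 / 10000) * M n)) := by
          refine hbad.trans ?_
          gcongr
          exact pow_min_mul_pow_min_le (hN n) (hk n)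
      _ = 2 * Real.exp (15 * (k n * Real.log (N n)) + 7 + -(8 / 10000) * M n) := by
          rw [Real.exp_add _ (-(8 / 10000) * (M n : ℝ))]
          ring
      _ ≤ 2 * Real.exp (-(1 / 2000 * (M n : ℝ))) := by
          gcongr
          linarith
      _ < 3 * Real.exp (-(1 / 2000 * (M n : ℝ))) := by
          gcongr
          norm_num
  set G : Set Ω := _
  change _ < P.real G
  have hsub : Bᶜ ⊆ G := by
    intro ω hω
    have hgood := not_not.1 hω
    have hcard : Fintype.card (Fin (N n)) = N n := Fintype.card_fin _
    have hR : ∀ R : Finset (Fin (M n)), 9999 / 10000 * (M n : ℝ) ≤ R.card →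
        √(rhoPlus (k n) (rowSub (Φ ω) R)) ≤ 17 / 16 * √(R.card : ℝ) ∧
          15 / 16 * √(R.card : ℝ) ≤ √(rhoMinus (k n) (rowSub (Φ ω) R)) := by
      intro R hR
      refine ⟨sqrt_rhoPlus_le (by positivity) fun T hT w => ?_,
        le_sqrt_rhoMinus (hk n) (by positivity) fun T hT w => ?_⟩
      · exact (hgood R hR T (hT.trans (by rw [hcard])) w).1
      · exact (hgood R hR T (hT.trans (by rw [hcard])) w).2
    have hU : 9999 / 10000 * (M n : ℝ) ≤ ((Finset.univ : Finset (Fin (M n))).card : ℝ) := by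
      rw [Finset.card_univ, Fintype.card_fin]
      linarith
    have hfull := hgood Finset.univ hU
    simp only [norm_toEuclideanLin_rowSub_univ, Finset.card_univ, Fintype.card_fin] at hfull
    simp only [G, Set.mem_ofPred_eq, add_zero, sub_zero]
    refine ⟨sqrt_rhoPlus_le (by positivity) fun T hT w =>
        (hfull T (hT.trans (by rw [hcard])) w).1,
      le_sqrt_rhoMinus (hk n) (by positivity) fun T hT w =>
        (hfull T (hT.trans (by rw [hcard])) w).2, fun R χ hχ hτ => hR R ?_⟩
    -- Since `0 ≤ χ ≤ 1`, the logarithm is nonpositive and the hypothesis bounds `χ` itself.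
    have hRM : (R.card : ℝ) ≤ M n := by
      exact_mod_cast (by simpa using Finset.card_le_univ R : R.card ≤ M n)
    have hM0 : (0 : ℝ) < M n := by linarith
    have hχ0 : 0 ≤ χ := by
      rw [hχ]
      exact div_nonneg (by linarith) hM0.le
    have hχ1 : χ ≤ 1 := by
      rw [hχ, div_le_one hM0]
      linarith [(Nat.cast_nonneg R.card : (0 : ℝ) ≤ R.card)]
    have hlog := Real.log_nonpos hχ0 hχ1
    have hχτ : χ ≤ 1 / 10000 := by nlinarith
    rw [hχ, div_le_iff₀ hM0] at hχτ
    linarith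
  -- `G` need not be measurable, so its measure is bounded below by subadditivity.
  have hone : 1 ≤ P.real G + P.real B := by
    calc (1 : ℝ) = P.real Set.univ := probReal_univ.symm
      _ ≤ P.real (G ∪ B) := measureReal_mono fun ω _ => by
          by_cases h : ω ∈ B
          exacts [Or.inr h, Or.inl (hsub h)]
      _ ≤ P.real G + P.real B := measureReal_union_le _ _
  linarith
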